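/- For a set $\Lambda\subseteq\mathbb Z$, the Sidon constant of $\Lambda$ is the least $C\ge 0$ such that $$\sum_{\lambda\in\Lambda}|c_\lambda|\le C\,\max_{|z|=1}\Bigl|\sum_{\lambda\in\Lambda}c_\lambda z^\lambda\Bigr|$$ for all finitely supported families $(c_\lambda)_{\lambda\in\Lambda}$ of complex numbers; it is $+\infty$ if there is no such $C$. (1) Let $\Lambda\subseteq\mathbb Z$. If there are an integer $q\ge 2$ and integers $\lambda$ and $\mu\ne 0$ such that $\Lambda\supseteq\{\lambda,\lambda+\mu,\lambda+q\mu\}$, then the Sidon constant of $\Lambda$ is at least $\sec\bigl(\frac{\pi}{2q}\bigr)$, and $$\sec\Bigl(\frac{\pi}{2q}\Bigr)>1+\frac{\pi^2}{8q^2}.$$ (2) Let $q$ be an integer with $|q|\ge 3$. Then the Sidon constant $C$ of the set $\{q^k : k\in\mathbb Z,\ k\ge 0\}$ satisfies $$1+\frac{\pi^2}{8\max(-q,q+1)^2}<C\le 1+\frac{\pi^2}{2q^2-2-\pi^2}.$$ -/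

import Mathlib

open scoped NNReal ENNReal

noncomputable section

/-- The character `e_n : z ↦ z ^ n` of the unit circle, as an element of `C(𝕋)`. -/
def circleChar (n : ℤ) : C(Circle, ℂ) where
  toFun z := ((z ^ n : Circle) : ℂ)
  continuous_toFun := continuous_subtype_val.comp (continuous_zpow n)

/-- The trigonometric polynomial `∑ c_n e_n`. Its norm in `C(Circle, ℂ)` is the maximum of its
modulus on the circle. -/
def trigPoly (c : ℤ →₀ ℂ) : C(Circle, ℂ) :=
  c.sum fun n a => a • circleChar n

/-- `∑ |c_n| ≤ C ‖∑ c_n e_n‖_∞` for all trigonometric polynomials with spectrum in `Λ`. -/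
def SidonBound (Λ : Set ℤ) (C : ℝ≥0) : Prop :=
  ∀ c : ℤ →₀ ℂ, (c.support : Set ℤ) ⊆ Λ → (c.sum fun _ a => ‖a‖) ≤ C * ‖trigPoly c‖

/-- The Sidon constant of `Λ`: the optimal `C` in the Sidon inequality. It is `∞` if there is no
such `C`, that is if `Λ` is not a Sidon set. -/
def sidonConstant (Λ : Set ℤ) : ℝ≥0∞ :=
  ⨅ (C : ℝ≥0) (_ : SidonBound Λ C), (C : ℝ≥0∞)

end

/-! Lower bound: with ζ = exp(iπ/n), the trinomial (n - 1) + nζw + w^n has coefficient sum 2n. Fejér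
weights on the points wω^k, where ω = exp(2πi/n), make it an average of the numbers nw(ω^k + ζ).
Since ζ lies midway between two consecutive n-th roots of unity, its modulus is at most 2n
cos(π/(2n)) (`norm_trinomial_le`).

Upper bound: it suffices to find t such that q^k t is close to -arg c_k mod 2π in mean square with
weights |c_k|, because cos x ≥ 1 - x²/2. Such a t is built one frequency at a time
(`exists_phases`). Matching phase m exactly adds at most π² |c_k| q^(2k-2m) to the error of each k <
m, and these increments sum to less than π² |c_k| / (q² - 1). -/

theorem trigPoly_apply (c : ℤ →₀ ℂ) (z : Circle) :
    trigPoly c z = c.sum fun n a => a * (z : ℂ) ^ n := by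
  simp [trigPoly, Finsupp.sum, circleChar, ContinuousMap.sum_apply]

/-! ### A trinomial of small maximum modulus -/

theorem sum_pow_eq_zero_of_pow_eq_one {x : ℂ} {n : ℕ} (h : x ^ n = 1) (hx : x ≠ 1) :
    ∑ k ∈ Finset.range n, x ^ k = 0 := by
  have := mul_geom_sum x n
  rw [h, sub_self] at this
  exact (mul_eq_zero.1 this).resolve_left (sub_ne_zero.2 hx)

/-- Orthogonality of the characters of the group of `n`-th roots of unity. -/
theorem sum_pow_mul_conj_pow {ω : ℂ} {n : ℕ} (hω : IsPrimitiveRoot ω n) (hn : ‖ω‖ = 1)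
    {i j : ℕ} (hi : i < n) (hj : j < n) :
    ∑ k ∈ Finset.range n, (ω ^ k) ^ i * (starRingEnd ℂ) ((ω ^ k) ^ j) =
      if i = j then (n : ℂ) else 0 := by
  have hc : ω * (starRingEnd ℂ) ω = 1 := by rw [Complex.mul_conj']; simp [hn]
  have e : ∀ k, (ω ^ k) ^ i * (starRingEnd ℂ) ((ω ^ k) ^ j) =
      (ω ^ i * (starRingEnd ℂ) ω ^ j) ^ k := by
    intro k
    rw [map_pow, map_pow, mul_pow]
    ring
  simp_rw [e]
  split_ifs with h
  · subst h
    simp [← mul_pow, hc]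
  · apply sum_pow_eq_zero_of_pow_eq_one
    · have h1 := hω.pow_eq_one
      rw [mul_pow, ← pow_mul, ← pow_mul, mul_comm i, mul_comm j, pow_mul, pow_mul,
        ← map_pow, h1]
      simp
    · intro h2
      apply h
      apply hω.pow_inj hi hj
      calc ω ^ i = ω ^ i * (ω * (starRingEnd ℂ) ω) ^ j := by rw [hc]; simp
        _ = (ω ^ i * (starRingEnd ℂ) ω ^ j) * ω ^ j := by ring
        _ = ω ^ j := by rw [h2, one_mul]

theorem sum_conj_geomSum {ω w : ℂ} {n : ℕ} (hω : IsPrimitiveRoot ω n) (hn : ‖ω‖ = 1)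
    (hpos : 0 < n) :
    ∑ k ∈ Finset.range n, (starRingEnd ℂ) (∑ j ∈ Finset.range n, (w * ω ^ k) ^ j) = n := by
  simp_rw [map_sum]
  rw [Finset.sum_comm, Finset.sum_eq_single 0]
  · simp
  · intro j hj h0
    have := sum_pow_mul_conj_pow hω hn hpos (Finset.mem_range.1 hj)
    rw [if_neg (Ne.symm h0)] at this
    simp only [pow_zero, one_mul] at this
    simp_rw [mul_pow, map_mul, ← Finset.mul_sum]
    rw [this, mul_zero]
  · simp [hpos.ne']

/-- Parseval's identity on the n-th roots of unity: the total mass of the Fejér weights. -/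
theorem sum_norm_sq_geomSum {ω w : ℂ} {n : ℕ} (hω : IsPrimitiveRoot ω n) (hn : ‖ω‖ = 1)
    (hw : ‖w‖ = 1) :
    ∑ k ∈ Finset.range n, ((‖∑ j ∈ Finset.range n, (w * ω ^ k) ^ j‖ ^ 2 : ℝ) : ℂ) = n ^ 2 := by
  have hc : w * (starRingEnd ℂ) w = 1 := by rw [Complex.mul_conj']; simp [hw]
  push_cast
  simp_rw [← Complex.mul_conj', map_sum, Finset.sum_mul_sum]
  rw [Finset.sum_comm]
  have : ∀ i ∈ Finset.range n, ∑ k ∈ Finset.range n, ∑ j ∈ Finset.range n,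
      (w * ω ^ k) ^ i * (starRingEnd ℂ) ((w * ω ^ k) ^ j) = (n : ℂ) := by
    intro i hi
    rw [Finset.sum_comm]
    have : ∀ j ∈ Finset.range n, ∑ k ∈ Finset.range n,
        (w * ω ^ k) ^ i * (starRingEnd ℂ) ((w * ω ^ k) ^ j) =
        if i = j then (n : ℂ) else 0 := by
      intro j hj
      have e : ∀ k, (w * ω ^ k) ^ i * (starRingEnd ℂ) ((w * ω ^ k) ^ j) =
          (w ^ i * (starRingEnd ℂ) w ^ j) * ((ω ^ k) ^ i * (starRingEnd ℂ) ((ω ^ k) ^ j)) := by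
        intro k
        rw [mul_pow, mul_pow, map_mul, map_pow _ w]
        ring
      simp_rw [e]
      rw [← Finset.mul_sum, sum_pow_mul_conj_pow hω hn (Finset.mem_range.1 hi)
        (Finset.mem_range.1 hj)]
      split_ifs with h
      · subst h
        rw [← mul_pow, hc, one_pow, one_mul]
      · simp
    rw [Finset.sum_congr rfl this]
    simp [Finset.mem_range.1 hi]
  rw [Finset.sum_congr rfl this]
  simp [sq]

/-- The points of a hypocycloid are convex combinations of its cusps, with the values of a Fejér
kernel as weights. -/
theorem hypocycloid_eq_sum {ω w : ℂ} {n : ℕ} (hω : IsPrimitiveRoot ω n) (hn : ‖ω‖ = 1)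
    (hpos : 0 < n) (hw : ‖w‖ = 1) :
    ∑ k ∈ Finset.range n, ((‖∑ j ∈ Finset.range n, (w * ω ^ k) ^ j‖ ^ 2 : ℝ) : ℂ) * (w * ω ^ k) =
      n * ((n - 1) + w ^ n) := by
  -- For x = wω^k and S = 1 + x + ... + x^(n-1), one has xS = S + (w^n - 1); multiply by the
  -- conjugate of S.
  have e : ∀ k, ((‖∑ j ∈ Finset.range n, (w * ω ^ k) ^ j‖ ^ 2 : ℝ) : ℂ) * (w * ω ^ k) =
      ((‖∑ j ∈ Finset.range n, (w * ω ^ k) ^ j‖ ^ 2 : ℝ) : ℂ) +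
      (w ^ n - 1) * (starRingEnd ℂ) (∑ j ∈ Finset.range n, (w * ω ^ k) ^ j) := by
    intro k
    have h := mul_geom_sum (w * ω ^ k) n
    have h1 : (w * ω ^ k) ^ n = w ^ n := by
      rw [mul_pow, ← pow_mul, mul_comm k, pow_mul, hω.pow_eq_one, one_pow, mul_one]
    rw [h1] at h
    push_cast
    rw [← Complex.mul_conj', ← h]
    ring
  simp_rw [e]
  rw [Finset.sum_add_distrib, ← Finset.mul_sum, sum_conj_geomSum hω hn hpos,
    sum_norm_sq_geomSum hω hn hw]
  ring

theorem norm_exp_add_exp (a b : ℝ) :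
    ‖Complex.exp (a * Complex.I) + Complex.exp (b * Complex.I)‖ = 2 * |Real.cos ((a - b) / 2)| := by
  have : Complex.exp (a * Complex.I) + Complex.exp (b * Complex.I) =
      Complex.exp (((a + b) / 2 : ℝ) * Complex.I) * ((2 * Real.cos ((a - b) / 2) : ℝ) : ℂ) := by
    push_cast
    rw [Complex.two_cos, mul_add, ← Complex.exp_add, ← Complex.exp_add]
    congr 2 <;> ring
  rw [this, norm_mul, Complex.norm_exp_ofReal_mul_I, one_mul, Complex.norm_real, Real.norm_eq_abs,
    abs_mul, abs_two]

/-- The angle is (2k - 1)x with x = π/(2n): it is -x for k = 0 and lies in [x, π - x] otherwise. -/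
theorem abs_cos_odd_mul_le {n k : ℕ} (hk : k < n) :
    |Real.cos ((k * (2 * Real.pi / n) - Real.pi / n) / 2)| ≤ Real.cos (Real.pi / (2 * n)) := by
  have hn : (0 : ℝ) < n := by exact_mod_cast (Nat.zero_le k).trans_lt hk
  have hpi := Real.pi_pos
  have hx : 0 < Real.pi / (2 * n) := by positivity
  set x := Real.pi / (2 * n) with hxd
  have hnx : 2 * n * x = Real.pi := by rw [hxd]; field_simp
  have e : (k * (2 * Real.pi / n) - Real.pi / n) / 2 = (2 * k - 1) * x := by
    rw [hxd]; field_simp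
  have hkn : (k : ℝ) + 1 ≤ n := by exact_mod_cast hk
  rw [e]
  rcases Nat.eq_zero_or_pos k with rfl | hk0
  · have h1 : (1 : ℝ) ≤ n := by simpa using hkn
    have h0 : 0 ≤ Real.cos x := Real.cos_nonneg_of_mem_Icc ⟨by linarith, by nlinarith⟩
    simp [abs_of_nonneg h0]
  · have hk1 : (1 : ℝ) ≤ k := by exact_mod_cast hk0
    have h1 : x ≤ (2 * k - 1) * x := by nlinarith
    have h2 : (2 * k - 1) * x ≤ Real.pi - x := by nlinarith
    rw [abs_le]
    constructor
    · rw [← Real.cos_pi_sub]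
      exact Real.cos_le_cos_of_nonneg_of_le_pi (by linarith) (by linarith) h2
    · exact Real.cos_le_cos_of_nonneg_of_le_pi hx.le (by linarith) h1

theorem norm_trinomial_le {n : ℕ} (hpos : 0 < n) {w : ℂ} (hw : ‖w‖ = 1) :
    ‖((n : ℂ) - 1) + n * Complex.exp ((Real.pi / n : ℝ) * Complex.I) * w + w ^ n‖ ≤
      2 * n * Real.cos (Real.pi / (2 * n)) := by
  have hω := Complex.isPrimitiveRoot_exp n hpos.ne'
  set ω := Complex.exp (2 * Real.pi * Complex.I / n) with hωd
  set ζ := Complex.exp ((Real.pi / n : ℝ) * Complex.I) with hζd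
  have hn : ‖ω‖ = 1 := hω.norm'_eq_one hpos.ne'
  have hn0 : (0 : ℝ) < n := by exact_mod_cast hpos
  have key : (n : ℂ) * (((n : ℂ) - 1) + n * ζ * w + w ^ n) =
      ∑ k ∈ Finset.range n, ((‖∑ j ∈ Finset.range n, (w * ω ^ k) ^ j‖ ^ 2 : ℝ) : ℂ) *
        (w * (ω ^ k + ζ)) := by
    simp_rw [mul_add, Finset.sum_add_distrib, ← Finset.sum_mul]
    rw [hypocycloid_eq_sum hω hn hpos hw, sum_norm_sq_geomSum hω hn hw]
    ring
  have hsum : ∑ k ∈ Finset.range n, ‖∑ j ∈ Finset.range n, (w * ω ^ k) ^ j‖ ^ 2 = (n : ℝ) ^ 2 := by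
    exact_mod_cast sum_norm_sq_geomSum hω hn hw
  have hle : ∀ k ∈ Finset.range n, ‖w * (ω ^ k + ζ)‖ ≤ 2 * Real.cos (Real.pi / (2 * n)) := by
    intro k hk
    have e : ω ^ k = Complex.exp ((k * (2 * Real.pi / n) : ℝ) * Complex.I) := by
      rw [hωd, ← Complex.exp_nat_mul]
      push_cast
      congr 1
      ring
    rw [norm_mul, hw, one_mul, e, hζd, norm_exp_add_exp]
    exact mul_le_mul_of_nonneg_left (abs_cos_odd_mul_le (Finset.mem_range.1 hk)) zero_le_two
  have h : ‖(n : ℂ) * (((n : ℂ) - 1) + n * ζ * w + w ^ n)‖ ≤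
      (n : ℝ) ^ 2 * (2 * Real.cos (Real.pi / (2 * n))) := by
    rw [key, ← hsum, Finset.sum_mul]
    refine (norm_sum_le _ _).trans (Finset.sum_le_sum fun k hk => ?_)
    rw [norm_mul, Complex.norm_real, Real.norm_of_nonneg (by positivity)]
    exact mul_le_mul_of_nonneg_left (hle k hk) (by positivity)
  rw [norm_mul, Complex.norm_natCast] at h
  refine le_of_mul_le_mul_left (h.trans_eq ?_) hn0
  ring

/-! ### The lower bound -/

theorem ofReal_sec_le_sidonConstant {Λ : Set ℤ} {n : ℕ} {l m : ℤ} (hn : 2 ≤ n) (hm : m ≠ 0)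
    (h : ({l, l + m, l + n * m} : Set ℤ) ⊆ Λ) :
    ENNReal.ofReal (1 / Real.cos (Real.pi / (2 * n))) ≤ sidonConstant Λ := by
  have hn2 : (2 : ℝ) ≤ n := by exact_mod_cast hn
  have hpi := Real.pi_pos
  have hcos : 0 < Real.cos (Real.pi / (2 * n)) := by
    apply Real.cos_pos_of_mem_Ioo
    constructor
    · have : 0 < Real.pi / (2 * n) := by positivity
      linarith
    · apply div_lt_div_of_pos_left hpi two_pos
      linarith
  refine le_iInf₂ fun C hC => ?_
  rw [← ENNReal.ofReal_coe_nnreal]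
  apply ENNReal.ofReal_le_ofReal
  rw [div_le_iff₀ hcos]
  set ζ := Complex.exp ((Real.pi / n : ℝ) * Complex.I) with hζd
  have hζ : ‖ζ‖ = 1 := Complex.norm_exp_ofReal_mul_I _
  have h12 : l ≠ l + m := by simpa using hm
  have h13 : l ≠ l + n * m := by
    have : (n : ℤ) * m ≠ 0 := mul_ne_zero (by omega) hm
    omega
  have h23 : l + m ≠ l + n * m := by
    intro e
    have : ((n : ℤ) - 1) * m = 0 := by linarith
    rcases mul_eq_zero.1 this with h | h
    · omega
    · exact hm h
  let d : ℤ → ℂ := fun x => if x = l then (n : ℂ) - 1 else if x = l + m then n * ζ else 1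
  let c : ℤ →₀ ℂ := Finsupp.onFinset {l, l + m, l + n * m}
    (fun x => if x ∈ ({l, l + m, l + n * m} : Finset ℤ) then d x else 0)
    (fun x hx => by
      by_contra hx'
      exact hx (if_neg hx'))
  have hsupp : c.support ⊆ {l, l + m, l + n * m} := Finsupp.support_onFinset_subset
  have hcl : c l = (n : ℂ) - 1 := by simp [c, d]
  have hcm : c (l + m) = n * ζ := by simp [c, d, hm]
  have hcn : c (l + n * m) = 1 := by
    simp only [c, d, Finsupp.onFinset_apply]
    rw [if_pos (by simp), if_neg h13.symm, if_neg h23.symm]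
  have hsum : ∀ {M : Type} [AddCommMonoid M] (g : ℤ → ℂ → M), (∀ x, g x 0 = 0) →
      c.sum g = g l ((n : ℂ) - 1) + (g (l + m) (n * ζ) + g (l + n * m) 1) := by
    intro M _ g hg
    rw [Finsupp.sum_of_support_subset _ hsupp _ (fun x _ => hg x), Finset.sum_insert,
      Finset.sum_pair h23, hcl, hcm, hcn]
    simp [h12, h13]
  have hb := hC c ((Finset.coe_subset.2 hsupp).trans (by simpa using h))
  rw [hsum _ (fun _ => norm_zero)] at hb
  have hleft : ‖(n : ℂ) - 1‖ + (‖(n : ℂ) * ζ‖ + ‖(1 : ℂ)‖) = 2 * n := by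
    have : ‖(n : ℂ) - 1‖ = (n : ℝ) - 1 := by
      rw [show (n : ℂ) - 1 = (((n : ℝ) - 1 : ℝ) : ℂ) by push_cast; rfl, Complex.norm_real,
        Real.norm_of_nonneg (by linarith)]
    rw [this, norm_mul, hζ, Complex.norm_natCast, norm_one]
    ring
  rw [hleft] at hb
  have hnorm : ‖trigPoly c‖ ≤ 2 * n * Real.cos (Real.pi / (2 * n)) := by
    rw [ContinuousMap.norm_le _ (by positivity)]
    intro z
    have hz : (z : ℂ) ≠ 0 := z.coe_ne_zero
    have hzm : ‖(z : ℂ) ^ m‖ = 1 := by rw [norm_zpow, Circle.norm_coe, one_zpow]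
    have e : trigPoly c z = (z : ℂ) ^ l *
        (((n : ℂ) - 1) + n * ζ * (z : ℂ) ^ m + ((z : ℂ) ^ m) ^ n) := by
      rw [trigPoly_apply, hsum (fun x a => a * (z : ℂ) ^ x) (fun _ => zero_mul _), zpow_add₀ hz, zpow_add₀ hz,
        mul_comm (n : ℤ) m, zpow_mul, zpow_natCast]
      ring
    rw [e, norm_mul, norm_zpow, Circle.norm_coe, one_zpow, one_mul]
    exact norm_trinomial_le (by omega) hzm
  have h3 := hb.trans (mul_le_mul_of_nonneg_left hnorm C.2)
  have hn0 : (0 : ℝ) < 2 * n := by linarith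
  refine le_of_mul_le_mul_left ?_ hn0
  calc 2 * (n : ℝ) * 1 = 2 * n := mul_one _
    _ ≤ C * (2 * n * Real.cos (Real.pi / (2 * n))) := h3
    _ = _ := by ring

theorem one_add_sq_div_two_lt_sec {x : ℝ} (h0 : 0 < x) (h1 : x ≤ 1) :
    1 + x ^ 2 / 2 < 1 / Real.cos x := by
  have hc : 0 < Real.cos x := Real.cos_pos_of_le_one (by rwa [abs_of_pos h0])
  have hb := (abs_le.1 (Real.cos_bound (x := x) (by rwa [abs_of_pos h0]))).2
  rw [abs_of_pos h0] at hb
  rw [lt_div_iff₀ hc]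
  have h2 : x ^ 2 ≤ 1 := by nlinarith
  have h4 : 0 < x ^ 4 := by positivity
  have h3 : (1 + x ^ 2 / 2) * Real.cos x ≤
      (1 + x ^ 2 / 2) * (1 - x ^ 2 / 2 + x ^ 4 * (5 / 96)) :=
    mul_le_mul_of_nonneg_left (by linarith) (by positivity)
  -- The product is 1 - x⁴/4 + 5x⁴/96 + 5x⁶/192, and 5/96 + 5/192 < 1/4.
  nlinarith [mul_le_mul_of_nonneg_left h2 h4.le]

theorem one_add_lt_sec {q : ℝ} (hq : 2 ≤ q) :
    1 + Real.pi ^ 2 / (8 * q ^ 2) < 1 / Real.cos (Real.pi / (2 * q)) := by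
  have hpi := Real.pi_pos
  have h := one_add_sq_div_two_lt_sec (x := Real.pi / (2 * q)) (by positivity)
    (by rw [div_le_one (by positivity)]; linarith [Real.pi_le_four])
  convert h using 2
  field_simp
  norm_num

theorem ofReal_lt_sidonConstant {Λ : Set ℤ} {n : ℕ} {l m : ℤ} (hn : 2 ≤ n) (hm : m ≠ 0)
    (h : ({l, l + m, l + n * m} : Set ℤ) ⊆ Λ) :
    ENNReal.ofReal (1 + Real.pi ^ 2 / (8 * (n : ℝ) ^ 2)) < sidonConstant Λ := by
  have h1 : 1 + Real.pi ^ 2 / (8 * (n : ℝ) ^ 2) < 1 / Real.cos (Real.pi / (2 * (n : ℝ))) :=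
    one_add_lt_sec (by exact_mod_cast hn)
  refine lt_of_lt_of_le ?_ (ofReal_sec_le_sidonConstant hn hm h)
  have h2 : 0 < 1 + Real.pi ^ 2 / (8 * (n : ℝ) ^ 2) := by positivity
  exact (ENNReal.ofReal_lt_ofReal_iff (h2.trans h1)).2 h1

/-! ### The upper bound -/

/-- A quadratic function with leading coefficient `W` increases by at most `W d ^ 2 / 4` at one
end of any interval of length `d` around the point. -/
theorem quadratic_le_or_le {W L x d : ℝ} (hW : 0 ≤ W) (hd : 0 < d) (hx : 0 ≤ x) (hxd : x < d) :
    W * x ^ 2 + 2 * L * x ≤ W * d ^ 2 / 4 ∨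
      W * (x - d) ^ 2 + 2 * L * (x - d) ≤ W * d ^ 2 / 4 := by
  by_contra! h
  -- The weights d - x and x cancel the linear terms and leave W d x (d - x).
  have h1 := mul_lt_mul_of_pos_left h.1 (sub_pos.2 hxd)
  have h2 := mul_le_mul_of_nonneg_left h.2.le hx
  have h3 : W * d * (x * (d - x)) ≤ W * d * (d ^ 2 / 4) :=
    mul_le_mul_of_nonneg_left (by nlinarith [sq_nonneg (d - 2 * x)]) (by positivity)
  nlinarith

theorem exists_step {W L t τ d : ℝ} (hW : 0 ≤ W) (hd : 0 < d) :
    ∃ j : ℤ, W * (τ + j * d - t) ^ 2 + 2 * L * (τ + j * d - t) ≤ W * d ^ 2 / 4 := by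
  have hx0 := mul_nonneg (Int.fract_nonneg ((τ - t) / d)) hd.le
  have hx1 := mul_lt_mul_of_pos_right (Int.fract_lt_one ((τ - t) / d)) hd
  have e : τ - t = ⌊(τ - t) / d⌋ * d + Int.fract ((τ - t) / d) * d := by
    rw [← add_mul, Int.floor_add_fract, div_mul_cancel₀ _ hd.ne']
  rw [one_mul] at hx1
  rcases quadratic_le_or_le (L := L) hW hd hx0 hx1 with h | h
  · refine ⟨-⌊(τ - t) / d⌋, ?_⟩
    have : τ + ((-⌊(τ - t) / d⌋ : ℤ) : ℝ) * d - t = Int.fract ((τ - t) / d) * d := by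
      push_cast
      linarith
    rwa [this]
  · refine ⟨-⌊(τ - t) / d⌋ - 1, ?_⟩
    have : τ + ((-⌊(τ - t) / d⌋ - 1 : ℤ) : ℝ) * d - t = Int.fract ((τ - t) / d) * d - d := by
      push_cast
      linarith
    rwa [this]

/-- Simultaneous approximation of prescribed phases along a geometric progression, in weighted
mean square. -/
theorem exists_phases {q : ℝ} (hq : 1 < q ^ 2) (φ r : ℕ → ℝ) (hr : ∀ k, 0 ≤ r k) (n : ℕ) :
    ∃ s : ℕ → ℝ, (∀ k ≤ n, ∃ j : ℤ, q ^ k * s k = φ k + j * (2 * Real.pi)) ∧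
      ∑ k ∈ Finset.range (n + 1), r k * (q ^ 2) ^ k * (s n - s k) ^ 2 ≤
        Real.pi ^ 2 / (q ^ 2 - 1) *
          ∑ k ∈ Finset.range (n + 1), r k * (1 - (q ^ 2) ^ k / (q ^ 2) ^ n) := by
  have hpi := Real.pi_pos
  have hq0 : q ≠ 0 := by
    rintro rfl
    norm_num at hq
  induction n with
  | zero =>
    refine ⟨fun _ => φ 0, ?_, by simp⟩
    intro k hk
    obtain rfl : k = 0 := by omega
    exact ⟨0, by simp⟩
  | succ n ih =>
    obtain ⟨s, hs, hb⟩ := ih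
    -- Replacing s n by t changes the weighted error by W (t - s n)² + 2 L (t - s n).
    set W := ∑ k ∈ Finset.range (n + 1), r k * (q ^ 2) ^ k with hWd
    set L := ∑ k ∈ Finset.range (n + 1), r k * (q ^ 2) ^ k * (s n - s k) with hLd
    have hW : 0 ≤ W := Finset.sum_nonneg fun k _ => mul_nonneg (hr k) (by positivity)
    have hd : 0 < 2 * Real.pi / |q ^ (n + 1)| := by positivity
    obtain ⟨j, hj⟩ := exists_step (L := L) (t := s n) (τ := φ (n + 1) / q ^ (n + 1)) hW hd
    set t := φ (n + 1) / q ^ (n + 1) + j * (2 * Real.pi / |q ^ (n + 1)|) with htd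
    have ht : ∃ i : ℤ, q ^ (n + 1) * t = φ (n + 1) + i * (2 * Real.pi) := by
      rcases abs_choice (q ^ (n + 1)) with h | h
      · refine ⟨j, ?_⟩
        rw [htd, h]
        field_simp
      · refine ⟨-j, ?_⟩
        rw [htd, h]
        push_cast
        field_simp
    refine ⟨fun k => if k ≤ n then s k else t, ?_, ?_⟩
    · intro k hk
      rcases Nat.lt_or_ge n k with h | h
      · obtain rfl : k = n + 1 := by omega
        simpa using ht
      · simpa [h] using hs k h
    · have e1 : ∑ k ∈ Finset.range (n + 1), r k * (q ^ 2) ^ k * (t - s k) ^ 2 =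
          ∑ k ∈ Finset.range (n + 1), r k * (q ^ 2) ^ k * (s n - s k) ^ 2 +
            (W * (t - s n) ^ 2 + 2 * L * (t - s n)) := by
        rw [hWd, hLd, Finset.sum_mul, Finset.mul_sum, Finset.sum_mul, ← Finset.sum_add_distrib,
          ← Finset.sum_add_distrib]
        refine Finset.sum_congr rfl fun k _ => ?_
        ring
      -- The increment W d²/4, with d = 2π/|q^(n+1)|, is exactly the next term of the geometric
      -- series.
      have e2 : Real.pi ^ 2 / (q ^ 2 - 1) *
          ∑ k ∈ Finset.range (n + 1), r k * (1 - (q ^ 2) ^ k / (q ^ 2) ^ (n + 1)) =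
          Real.pi ^ 2 / (q ^ 2 - 1) *
            ∑ k ∈ Finset.range (n + 1), r k * (1 - (q ^ 2) ^ k / (q ^ 2) ^ n) +
          W * (2 * Real.pi / |q ^ (n + 1)|) ^ 2 / 4 := by
        have h2 : (2 * Real.pi / |q ^ (n + 1)|) ^ 2 = 4 * Real.pi ^ 2 / (q ^ 2) ^ (n + 1) := by
          rw [div_pow, sq_abs, ← pow_mul, ← pow_mul, mul_comm (n + 1) 2]
          ring
        rw [h2, hWd, Finset.mul_sum, Finset.mul_sum, Finset.sum_mul, Finset.sum_div,
          ← Finset.sum_add_distrib]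
        refine Finset.sum_congr rfl fun k _ => ?_
        have h3 : q ^ 2 - 1 ≠ 0 := by linarith
        rw [pow_succ]
        field_simp
        ring
      have e3 : ∑ k ∈ Finset.range (n + 1), r k * (q ^ 2) ^ k *
          ((if n + 1 ≤ n then s (n + 1) else t) - if k ≤ n then s k else t) ^ 2 =
          ∑ k ∈ Finset.range (n + 1), r k * (q ^ 2) ^ k * (t - s k) ^ 2 := by
        refine Finset.sum_congr rfl fun k hk => ?_
        rw [if_neg (by omega), if_pos (by have := Finset.mem_range.1 hk; omega)]
      rw [Finset.sum_range_succ, e3, e1, Finset.sum_range_succ _ (n + 1), mul_add, e2,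
        div_self (by positivity)]
      simp only [sub_self, mul_zero, add_zero, ne_eq, OfNat.ofNat_ne_zero, not_false_eq_true,
        zero_pow]
      linarith

theorem exists_le_sum_cos {q : ℝ} (hq : 1 < q ^ 2) (φ r : ℕ → ℝ) (hr : ∀ k, 0 ≤ r k) (n : ℕ) :
    ∃ t : ℝ, (1 - Real.pi ^ 2 / (2 * (q ^ 2 - 1))) * ∑ k ∈ Finset.range (n + 1), r k ≤
      ∑ k ∈ Finset.range (n + 1), r k * Real.cos (q ^ k * t - φ k) := by
  obtain ⟨s, hs, hb⟩ := exists_phases hq φ r hr n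
  have hpos : 0 < q ^ 2 - 1 := by linarith
  refine ⟨s n, ?_⟩
  have h1 : ∑ k ∈ Finset.range (n + 1), r k * (1 - (q ^ 2) ^ k / (q ^ 2) ^ n) ≤
      ∑ k ∈ Finset.range (n + 1), r k := by
    refine Finset.sum_le_sum fun k _ => mul_le_of_le_one_right (hr k) ?_
    have : 0 ≤ (q ^ 2) ^ k / (q ^ 2) ^ n := by positivity
    linarith
  have h2 := hb.trans (mul_le_mul_of_nonneg_left h1 (by positivity))
  have h3 : ∑ k ∈ Finset.range (n + 1), (r k - r k * (q ^ 2) ^ k * (s n - s k) ^ 2 / 2) ≤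
      ∑ k ∈ Finset.range (n + 1), r k * Real.cos (q ^ k * s n - φ k) := by
    refine Finset.sum_le_sum fun k hk => ?_
    obtain ⟨j, hj⟩ := hs k (by have := Finset.mem_range.1 hk; omega)
    have e : q ^ k * s n - φ k = q ^ k * (s n - s k) + j * (2 * Real.pi) := by linarith
    rw [e, Real.cos_add_int_mul_two_pi]
    have := mul_le_mul_of_nonneg_left
      (Real.one_sub_sq_div_two_le_cos (x := q ^ k * (s n - s k))) (hr k)
    refine le_trans (le_of_eq ?_) this
    rw [mul_pow, ← pow_mul, ← pow_mul, mul_comm k 2]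
    ring
  rw [Finset.sum_sub_distrib, ← Finset.sum_div] at h3
  refine le_trans (le_trans (le_of_eq ?_) (sub_le_sub_left
    (div_le_div_of_nonneg_right h2 zero_le_two) _)) h3
  field_simp

theorem pow_injective_of_three_le_abs {q : ℤ} (hq : 3 ≤ |q|) : Function.Injective fun k : ℕ => q ^ k :=
  Int.pow_right_injective (by rw [Int.abs_eq_natAbs] at hq; omega)

theorem sidonBound_geometric {q : ℤ} (hq : 3 ≤ |q|) {C : ℝ≥0}
    (hC : 1 ≤ C * (1 - Real.pi ^ 2 / (2 * ((q : ℝ) ^ 2 - 1)))) :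
    SidonBound (Set.range fun k : ℕ => q ^ k) C := by
  intro c hc
  have hinj := pow_injective_of_three_le_abs hq
  have hq2 : 1 < (q : ℝ) ^ 2 := by
    have : (3 : ℝ) ≤ |(q : ℝ)| := by exact_mod_cast hq
    rw [← sq_abs]
    nlinarith
  obtain ⟨n, hn⟩ : ∃ n : ℕ, c.support ⊆ (Finset.range (n + 1)).image fun k : ℕ => q ^ k := by
    obtain ⟨F, -, hF⟩ := Finset.subset_set_image_iff.1
      (show (c.support : Set ℤ) ⊆ (fun k : ℕ => q ^ k) '' Set.univ by rwa [Set.image_univ])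
    obtain ⟨n, hn⟩ := F.exists_nat_subset_range
    refine ⟨n, ?_⟩
    rw [← hF]
    exact Finset.image_subset_image (hn.trans (Finset.range_mono n.le_succ))
  have hsum : ∀ {M : Type} [AddCommMonoid M] (g : ℤ → ℂ → M), (∀ x, g x 0 = 0) →
      c.sum g = ∑ k ∈ Finset.range (n + 1), g (q ^ k) (c (q ^ k)) := by
    intro M _ g hg
    rw [Finsupp.sum_of_support_subset _ hn _ (fun x _ => hg x),
      Finset.sum_image fun _ _ _ _ h => hinj h]
  -- These target phases turn the cosine sum into the real part of the polynomial at exp(it).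
  obtain ⟨t, ht⟩ := exists_le_sum_cos hq2 (fun k => -(c (q ^ k)).arg) (fun k => ‖c (q ^ k)‖)
    (fun k => norm_nonneg _) n
  have hre : ∑ k ∈ Finset.range (n + 1), ‖c (q ^ k)‖ * Real.cos ((q : ℝ) ^ k * t -
      -(c (q ^ k)).arg) = (trigPoly c (Circle.exp t)).re := by
    rw [trigPoly_apply, hsum (fun x a => a * (Circle.exp t : ℂ) ^ x) (fun _ => zero_mul _),
      Complex.re_sum]
    refine Finset.sum_congr rfl fun k _ => ?_
    have e : c (q ^ k) * (Circle.exp t : ℂ) ^ (q ^ k) =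
        (‖c (q ^ k)‖ : ℂ) * Complex.exp (((q : ℝ) ^ k * t - -(c (q ^ k)).arg : ℝ) * Complex.I) := by
      conv_lhs => rw [← Complex.norm_mul_exp_arg_mul_I (c (q ^ k))]
      rw [Circle.coe_exp, ← Complex.exp_int_mul, mul_assoc, ← Complex.exp_add]
      push_cast
      congr 2
      ring
    rw [e, Complex.re_ofReal_mul, Complex.exp_ofReal_mul_I_re]
  rw [hsum _ (fun _ => norm_zero)]
  rw [hre] at ht
  have h1 := ht.trans ((Complex.re_le_norm _).trans ((trigPoly c).norm_coe_le_norm _))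
  have h2 := mul_le_mul_of_nonneg_left h1 C.2
  have h3 := mul_le_mul_of_nonneg_right hC
    (Finset.sum_nonneg fun k (_ : k ∈ Finset.range (n + 1)) => norm_nonneg (c (q ^ k)))
  rw [one_mul, mul_assoc] at h3
  exact h3.trans h2

theorem sidonConstant_geometric_le {q : ℤ} (hq : 3 ≤ |q|) :
    sidonConstant (Set.range fun k : ℕ => q ^ k) ≤
      ENNReal.ofReal (1 + Real.pi ^ 2 / (2 * (q : ℝ) ^ 2 - 2 - Real.pi ^ 2)) := by
  have hq2 : (9 : ℝ) ≤ (q : ℝ) ^ 2 := by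
    have : (3 : ℝ) ≤ |(q : ℝ)| := by exact_mod_cast hq
    rw [← sq_abs]
    nlinarith
  -- This uses |q| ≥ 3: for |q| = 2 the value 6 - π² is negative.
  have hpos : 0 < 2 * (q : ℝ) ^ 2 - 2 - Real.pi ^ 2 := by
    nlinarith [Real.pi_pos, Real.pi_lt_d2]
  refine iInf₂_le (Real.toNNReal _) (sidonBound_geometric hq ?_)
  rw [Real.coe_toNNReal _ (by positivity)]
  have h1 : (q : ℝ) ^ 2 - 1 ≠ 0 := by linarith
  have h2 := hpos.ne'
  apply le_of_eq
  rw [one_add_div h2, show 2 * (q : ℝ) ^ 2 - 2 - Real.pi ^ 2 + Real.pi ^ 2 =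
    2 * ((q : ℝ) ^ 2 - 1) by ring, one_sub_div (mul_ne_zero two_ne_zero h1),
    show 2 * ((q : ℝ) ^ 2 - 1) - Real.pi ^ 2 = 2 * (q : ℝ) ^ 2 - 2 - Real.pi ^ 2 by ring,
    div_mul_div_cancel₀ h2, div_self (mul_ne_zero two_ne_zero h1)]

theorem mainTheorem6 :
    (∀ (Λ : Set ℤ) (q l m : ℤ), 2 ≤ q → m ≠ 0 → ({l, l + m, l + q * m} : Set ℤ) ⊆ Λ →
      ENNReal.ofReal (1 / Real.cos (Real.pi / (2 * (q : ℝ)))) ≤ sidonConstant Λ ∧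
      1 + Real.pi ^ 2 / (8 * (q : ℝ) ^ 2) < 1 / Real.cos (Real.pi / (2 * (q : ℝ)))) ∧
    (∀ q : ℤ, 3 ≤ |q| →
      ENNReal.ofReal (1 + Real.pi ^ 2 / (8 * (max (-(q : ℝ)) ((q : ℝ) + 1)) ^ 2)) <
        sidonConstant (Set.range fun k : ℕ => q ^ k) ∧
      sidonConstant (Set.range fun k : ℕ => q ^ k) ≤
        ENNReal.ofReal (1 + Real.pi ^ 2 / (2 * (q : ℝ) ^ 2 - 2 - Real.pi ^ 2))) := by
  refine ⟨fun Λ q l m hq hm h => ⟨?_, one_add_lt_sec (by exact_mod_cast hq)⟩,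
    fun q hq => ⟨?_, sidonConstant_geometric_le hq⟩⟩
  · lift q to ℕ using by omega
    rw [Int.cast_natCast]
    exact ofReal_sec_le_sidonConstant (by omega) hm h
  · have hmem : ∀ k : ℕ, q ^ k ∈ Set.range fun k : ℕ => q ^ k := fun k => ⟨k, rfl⟩
    have h0 := hmem 0
    have h1 := hmem 1
    have h2 := hmem 2
    rcases le_abs.1 hq with h | h
    · have hr : (3 : ℝ) ≤ q := by exact_mod_cast h
      have e : max (-(q : ℝ)) ((q : ℝ) + 1) = ((q + 1).toNat : ℝ) := by
        rw [max_eq_right (by linarith)]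
        have : (((q + 1).toNat : ℤ) : ℝ) = ((q + 1 : ℤ) : ℝ) := by
          rw [Int.toNat_of_nonneg (by omega)]
        push_cast at this
        exact this.symm
      rw [e]
      -- The ratio (q² - 1)/(q - 1) is q + 1.
      refine ofReal_lt_sidonConstant (l := 1) (m := q - 1) (by omega) (by omega) ?_
      rw [Int.toNat_of_nonneg (by omega)]
      rintro x (rfl | rfl | rfl)
      · simpa using h0
      · simpa using h1
      · convert h2 using 1
        ring
    · have hr : (3 : ℝ) ≤ -q := by exact_mod_cast h
      have e : max (-(q : ℝ)) ((q : ℝ) + 1) = ((-q).toNat : ℝ) := by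
        rw [max_eq_left (by linarith)]
        have : (((-q).toNat : ℤ) : ℝ) = ((-q : ℤ) : ℝ) := by
          rw [Int.toNat_of_nonneg (by omega)]
        push_cast at this
        exact this.symm
      rw [e]
      -- Starting at q instead of 1 makes the ratio (q² - q)/(1 - q) = -q positive.
      refine ofReal_lt_sidonConstant (l := q) (m := 1 - q) (by omega) (by omega) ?_
      rw [Int.toNat_of_nonneg (by omega)]
      rintro x (rfl | rfl | rfl)
      · simpa using h1
      · simpa using h0
      · convert h2 using 1
        ring
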